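/- Let $d\ge 0$ and let $\Omega\subset\mathbb{R}^d$ be the frequency domain of real random fields on the grid $\mathbb{Z}^d$, that is, a fundamental domain (for instance $[-\pi,\pi]^d$) of the lattice of frequency periods spanned by a basis $b_1,\dots,b_d$ of $\mathbb{R}^d$. A zero-mean, wide-sense stationary real random field $z=(z_k)_{k\in\mathbb{Z}^d}$ has power spectral density $S_z\ge 0$ on $\Omega$ if $S_z$ is integrable on $\Omega$ and $$\mathbb{E}[z_jz_k]=\int_\Omega S_z(\omega)\,e^{2\pi i\sum_m (j_m-k_m)\omega_m}\,d\omega\qquad(j,k\in\mathbb{Z}^d),$$ where $\omega=\sum_m\omega_m b_m$. Its Gaussian reference model is the zero-mean Gaussian random field $g$ with the same autocovariance. The differential entropy rate of a random field is $h(g)=\lim_{n\to\infty} n^{-d}\,h\big((g_k)_{k\in\{0,\dots,n-1\}^d}\big)\in[-\infty,\infty)$, where $h$ of a random vector is its differential entropy. Let $P>0$. There is a real number $h_{\max}$, depending only on $d$, $\Omega$, $b_1,\dots,b_d$ and $P$, such that the following holds. For every zero-mean, wide-sense stationary random field $z$ with power spectral density $S_z>0$ almost everywhere on $\Omega$ and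 $\int_\Omega S_z(\omega)\,d\omega=P$, the differential entropy rate $h(g)$ of its Gaussian reference model $g$ exists and satisfies $h(g)\le h_{\max}$, with equality if and only if $$S_z(\omega)=\frac{P}{\mathrm{Vol}(\Omega)}\quad\text{for almost every }\omega\in\Omega .$$ Moreover the value $h_{\max}$ is attained: there is a zero-mean stationary Gaussian random field with the flat power spectral density $P/\mathrm{Vol}(\Omega)$, and its differential entropy rate is $h_{\max}$. -/

import Mathlib

open MeasureTheory ProbabilityTheory Filter Topology

noncomputable section

/-- The (Shannon) differential entropy `-∫ f log f` of a law `ν` on `ℝ^ι`, where `f` is the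
Lebesgue density of `ν`, as an extended real number. It is `-∞` if `ν` has no density; the
positive and negative parts of `-f log f` are integrated separately (and the undefined form
`∞ - ∞` is read as `-∞`). -/
def differentialEntropy {ι : Type*} [Fintype ι] (ν : Measure (ι → ℝ)) : EReal :=
  open Classical in
  if ν ≪ (volume : Measure (ι → ℝ)) then
    ((∫⁻ x, ENNReal.ofReal (Real.negMulLog (ν.rnDeriv volume x).toReal) : ENNReal) : EReal) -
      ((∫⁻ x, ENNReal.ofReal (-Real.negMulLog (ν.rnDeriv volume x).toReal) : ENNReal) : EReal)
  else ⊥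

section Field

variable {Ω : Type*} [MeasurableSpace Ω] {d : ℕ}

/-- The joint law of the samples of the field `z` on the cube `{0, …, n - 1}^d`. -/
def cubeLaw (z : (Fin d → ℤ) → Ω → ℝ) (μ : Measure Ω) (n : ℕ) :
    Measure ((Fin d → Fin n) → ℝ) :=
  μ.map fun ω k => z (fun i => ((k i : ℕ) : ℤ)) ω

/-- `h` is the differential entropy rate of the random field `z` on `ℤ^d`: the limit, as
`n → ∞`, of the differential entropy of the samples in `{0, …, n - 1}^d` divided by the number
`n ^ d` of samples. The value `-∞` is allowed. -/
def HasEntropyRate (z : (Fin d → ℤ) → Ω → ℝ) (μ : Measure Ω) (h : EReal) : Prop :=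
  Tendsto (fun n : ℕ => differentialEntropy (cubeLaw z μ n) / (((n : ℝ) ^ d : ℝ) : EReal))
    atTop (𝓝 h)

/-- A zero-mean, wide-sense stationary, real random field on `ℤ^d`. -/
structure IsCenteredWSS (z : (Fin d → ℤ) → Ω → ℝ) (μ : Measure Ω) : Prop where
  memLp : ∀ k, MemLp (z k) 2 μ
  mean_zero : ∀ k, ∫ ω, z k ω ∂μ = 0
  cov_shift : ∀ j k m, cov[z (j + m), z (k + m); μ] = cov[z j, z k; μ]

/-- `F` is a frequency domain for fields sampled on `ℤ^d`: one cell of the frequency space `ℝ^d`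
modulo the lattice of frequency periods spanned by the basis `b`. For `b` equal to `2π` times the
standard basis, `[-π, π]^d` is an example. -/
def IsFrequencyDomain (b : Module.Basis (Fin d) ℝ (EuclideanSpace ℝ (Fin d)))
    (F : Set (EuclideanSpace ℝ (Fin d))) : Prop :=
  IsAddFundamentalDomain (Submodule.span ℤ (Set.range b)) F volume

/-- The character of frequency `ξ` at the lag `k ∈ ℤ^d`, namely `exp (2πi ∑ kᵢ ξᵢ)` with `ξᵢ` the
coordinates of `ξ` in the basis `b` of frequency periods. For `b` equal to `2π` times the standard
basis this is `exp (i k · ξ)`. -/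
def freqChar (b : Module.Basis (Fin d) ℝ (EuclideanSpace ℝ (Fin d))) (k : Fin d → ℤ)
    (ξ : EuclideanSpace ℝ (Fin d)) : ℂ :=
  Complex.exp (2 * Real.pi * Complex.I * ((∑ i, (k i : ℝ) * b.repr ξ i : ℝ) : ℂ))

/-- `S` is the power spectral density of the field `z` on the frequency domain `F`: a nonnegative
integrable function whose Fourier coefficients are the autocovariances of `z`. In particular the
total power `∫_F S` is the variance of each sample. -/
structure HasPSD (b : Module.Basis (Fin d) ℝ (EuclideanSpace ℝ (Fin d)))
    (F : Set (EuclideanSpace ℝ (Fin d))) (z : (Fin d → ℤ) → Ω → ℝ) (μ : Measure Ω)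
    (S : EuclideanSpace ℝ (Fin d) → ℝ) : Prop where
  integrableOn : IntegrableOn S F volume
  nonneg : ∀ᵐ ξ ∂(volume.restrict F), 0 ≤ S ξ
  cov_eq : ∀ j k, ((cov[z j, z k; μ] : ℝ) : ℂ) = ∫ ξ in F, (S ξ : ℂ) * freqChar b (j - k) ξ

/-- `g` is a Gaussian reference model of the field `z`: a zero-mean Gaussian random field with the
same second-order statistics as `z`. -/
structure IsGaussianReference {Ω' : Type*} [MeasurableSpace Ω'] (g : (Fin d → ℤ) → Ω' → ℝ)
    (μ' : Measure Ω') (z : (Fin d → ℤ) → Ω → ℝ) (μ : Measure Ω) : Prop where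
  gaussian : IsGaussianProcess g μ'
  mean_zero : ∀ k, ∫ ω, g k ω ∂μ' = 0
  cov_eq : ∀ j k, cov[g j, g k; μ'] = cov[z j, z k; μ]

end Field

end

/-! ### Determinant inequalities for positive definite matrices. -/

namespace Matrix

open scoped MatrixOrder

variable {ι κ : Type*} [Fintype ι] [DecidableEq ι]

/-! The samples of `g` on a cube of side `n` form a centered Gaussian vector whose covariance matrix
`G` has diagonal `P` and is positive definite because `S > 0` a.e. Its entropy is `n ^ d * log (2πe)
/ 2 + log (det G) / 2`, and `log t ≤ t - 1` on eigenvalues gives `log (det G) ≤ n ^ d * log P`, with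
equality only for `G = P • 1`. Hence the bound `hmax = log (2πeP) / 2`.

The limit comes from tiling. By Fischer's inequality and stationarity, the deficit `log (det G) - n
^ d * log P` is at most `(n / m) ^ d` times the deficit of the cube of side `m`
(`logDetDeficit_le`). A Fekete argument then shows that the rate exists in `EReal` and equals the
infimum of the normalized entropies over all cubes.

That the limit is an infimum settles equality without any formula for it in terms of `∫ log S`. If
it equals `hmax`, every cube attains the bound, so all covariances at nonzero lags vanish. These are
the nonconstant Fourier coefficients of `S`, and uniqueness of Fourier coefficients
(`IsFrequencyDomain.measure_ext`) makes `S` flat. Conversely, a flat `S` has zero covariance at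
nonzero lags by orthogonality of characters. -/

theorem PosDef.log_det_eq_sum {A : Matrix ι ι ℝ} (hA : A.PosDef) :
    Real.log A.det = ∑ i, Real.log (hA.1.eigenvalues i) := by
  rw [hA.1.det_eq_prod_eigenvalues, ← Real.log_prod]
  · simp
  · exact fun i _ => (hA.eigenvalues_pos i).ne'

/-- This is `log t ≤ t - 1` summed over the eigenvalues. Both the Hadamard-type bound and Fischer's
inequality reduce to it. -/
theorem PosDef.log_det_le_trace_sub_card {A : Matrix ι ι ℝ} (hA : A.PosDef) :
    Real.log A.det ≤ A.trace - Fintype.card ι := by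
  rw [hA.log_det_eq_sum, hA.1.trace_eq_sum_eigenvalues]
  have h : ∑ i, Real.log (hA.1.eigenvalues i) ≤ ∑ i, (hA.1.eigenvalues i - 1) :=
    Finset.sum_le_sum fun i _ => Real.log_le_sub_one_of_pos (hA.eigenvalues_pos i)
  simpa using h

/-- Since `log t < t - 1` for `t ≠ 1`, equality of the sums forces every eigenvalue to be `1`, and
the spectral theorem concludes. -/
theorem PosDef.eq_one_of_log_det_eq {A : Matrix ι ι ℝ} (hA : A.PosDef)
    (h : Real.log A.det = A.trace - Fintype.card ι) : A = 1 := by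
  have hsum : ∑ i, Real.log (hA.1.eigenvalues i) = ∑ i, (hA.1.eigenvalues i - 1) := by
    rw [hA.log_det_eq_sum, hA.1.trace_eq_sum_eigenvalues] at h
    simpa using h
  have hev : hA.1.eigenvalues = fun _ => 1 := by
    funext i
    have hi := (Finset.sum_eq_sum_iff_of_le fun i _ =>
      Real.log_le_sub_one_of_pos (hA.eigenvalues_pos i)).1 hsum i (Finset.mem_univ i)
    by_contra hne
    exact (Real.log_lt_sub_one_of_pos (hA.eigenvalues_pos i) hne).ne hi
  have hs := hA.1.spectral_theorem
  rw [hev] at hs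
  rw [hs]
  have : diagonal (RCLike.ofReal ∘ fun _ : ι => (1 : ℝ)) = (1 : Matrix ι ι ℝ) := by
    ext i j; simp [diagonal, one_apply]
  rw [this, map_one]

/-- A positive definite `M` dominates `G` in determinant as soon as `tr (M⁻¹ G)` is at most
the dimension. -/
theorem PosDef.det_le_of_trace_le {G M : Matrix ι ι ℝ} (hG : G.PosDef) (hM : M.PosDef)
    (h : (M⁻¹ * G).trace ≤ Fintype.card ι) : G.det ≤ M.det := by
  -- With `M⁻¹ = Bᴴ * B`, the congruent matrix `B * G * Bᴴ` is positive definite, has the trace of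
  -- `M⁻¹ * G` and determinant `det G / det M`; the trace bound applies to it.
  obtain ⟨B, hB⟩ := CStarAlgebra.nonneg_iff_eq_star_mul_self.mp hM.inv.posSemidef.nonneg
  rw [star_eq_conjTranspose] at hB
  have hdet : M⁻¹.det = B.det * B.det := by
    rw [hB, det_mul, det_conjTranspose]; simp
  have hBdet : B.det ≠ 0 := by
    intro h0
    rw [h0] at hdet
    exact hM.inv.det_pos.ne' (by simpa using hdet)
  have hA : (B * G * Bᴴ).PosDef :=
    hG.mul_mul_conjTranspose_same (vecMul_injective_of_isUnit
      ((isUnit_iff_isUnit_det B).2 hBdet.isUnit))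
  have htr : (B * G * Bᴴ).trace = (M⁻¹ * G).trace := by
    rw [hB, Matrix.mul_assoc, trace_mul_comm, Matrix.mul_assoc, trace_mul_comm]
  have hlog := hA.log_det_le_trace_sub_card
  rw [htr] at hlog
  have hle : (B * G * Bᴴ).det ≤ 1 := by
    rw [← Real.log_nonpos_iff hA.det_pos.le]
    linarith
  have hd : (B * G * Bᴴ).det = M.det⁻¹ * G.det := by
    have h1 : M.det⁻¹ = B.det * B.det := by
      rw [← hdet, det_nonsing_inv, Ring.inverse_eq_inv']
    rw [h1, det_mul, det_mul, det_conjTranspose]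
    simp; ring
  rw [hd, inv_mul_le_iff₀ hM.det_pos, mul_one] at hle
  exact hle

/-- The block diagonal part of a matrix with respect to a colouring of the indices. -/
def blockPart {ι κ : Type*} [DecidableEq κ] (G : Matrix ι ι ℝ) (c : ι → κ) : Matrix ι ι ℝ :=
  of fun i j => if c i = c j then G i j else 0

theorem blockPart_blockTriangular {ι κ : Type*} [DecidableEq κ] [LinearOrder κ] (G : Matrix ι ι ℝ) (c : ι → κ) :
    (G.blockPart c).BlockTriangular c := fun i j hij => by
  simp [blockPart, hij.ne']

theorem PosDef.toSquareBlock {ι κ : Type*} {G : Matrix ι ι ℝ} (hG : G.PosDef) (c : ι → κ) (k : κ) :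
    (G.toSquareBlock c k).PosDef :=
  hG.submatrix Subtype.val_injective

variable [Fintype κ] [DecidableEq κ] [LinearOrder κ]

theorem det_blockPart (G : Matrix ι ι ℝ) (c : ι → κ) :
    (G.blockPart c).det = ∏ k, (G.toSquareBlock c k).det := by
  rw [(G.blockPart_blockTriangular c).det_fintype]
  refine Finset.prod_congr rfl fun k _ => ?_
  congr 1
  ext ⟨i, hi⟩ ⟨j, hj⟩
  simp [toSquareBlock_def, blockPart, hi, hj]

/-- The block part is the Hadamard product of `G` with the indicator of "same colour", which is a
Gram matrix, so the Schur product theorem gives semidefiniteness. The determinant, a product of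
principal minors, upgrades it to definiteness. -/
theorem PosDef.blockPart {G : Matrix ι ι ℝ} (hG : G.PosDef) (c : ι → κ) :
    (G.blockPart c).PosDef := by
  have hind : (of fun i j => if c i = c j then (1 : ℝ) else 0).PosSemidef := by
    have := posSemidef_conjTranspose_mul_self (of fun (a : κ) i => if c i = a then (1 : ℝ) else 0)
    convert this using 1
    ext i j
    simp [mul_apply, eq_comm]
  have hp : (G.blockPart c).PosSemidef := by
    have := hG.posSemidef.hadamard hind
    have he : G.blockPart c = G ⊙ of fun i j => if c i = c j then (1 : ℝ) else 0 := by
      ext i j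
      simp [Matrix.blockPart]
    rw [he]
    exact this
  rw [hp.posDef_iff_det_ne_zero, det_blockPart]
  exact Finset.prod_ne_zero_iff.2 fun k _ => (hG.toSquareBlock c k).det_pos.ne'

/-- **Fischer's inequality**: the determinant of a positive definite matrix is at most the product
of the determinants of its diagonal blocks. -/
theorem PosDef.det_le_prod_det_toSquareBlock {G : Matrix ι ι ℝ} (hG : G.PosDef) (c : ι → κ) :
    G.det ≤ ∏ k, (G.toSquareBlock c k).det := by
  rw [← det_blockPart]
  have hM := hG.blockPart c
  -- The inverse of the block part `M` is again block diagonal, so `tr (M⁻¹ * G)` sees only the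
  -- diagonal blocks of `G` and equals `tr (M⁻¹ * M)`.
  refine hG.det_le_of_trace_le hM (le_of_eq ?_)
  let := hM.isUnit.invertible
  have hinv := blockTriangular_inv_of_blockTriangular (G.blockPart_blockTriangular c)
  have hzero : ∀ i j, c i ≠ c j → (G.blockPart c)⁻¹ i j = 0 := by
    intro i j hij
    rcases hij.lt_or_gt with h | h
    · rw [← hM.inv.1.apply]
      simp [hinv h]
    · exact hinv h
  have h1 : ((G.blockPart c)⁻¹ * G).trace = ((G.blockPart c)⁻¹ * G.blockPart c).trace := by
    simp only [trace, diag_apply, mul_apply]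
    refine Finset.sum_congr rfl fun i _ => Finset.sum_congr rfl fun j _ => ?_
    by_cases h : c j = c i
    · simp [Matrix.blockPart, h]
    · rw [hzero i j (Ne.symm h)]; simp
  rw [h1, inv_mul_of_invertible, trace_one]

end Matrix

/-! ### Differential entropy of Gaussian vectors. -/

section GaussianEntropy

variable {ι : Type*} [Fintype ι]

/-- The differential entropy of a law with a density `f` whose logarithm is integrable. -/
theorem differentialEntropy_withDensity {f : (ι → ℝ) → ℝ} (hf : Measurable f)
    (hpos : ∀ x, 0 ≤ f x)
    [IsFiniteMeasure ((volume : Measure (ι → ℝ)).withDensity fun x => ENNReal.ofReal (f x))]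
    (hlog : Integrable (fun x => Real.log (f x))
      ((volume : Measure (ι → ℝ)).withDensity fun x => ENNReal.ofReal (f x))) :
    differentialEntropy ((volume : Measure (ι → ℝ)).withDensity fun x => ENNReal.ofReal (f x)) =
      ((-∫ x, Real.log (f x) ∂((volume : Measure (ι → ℝ)).withDensity
        fun x => ENNReal.ofReal (f x)) : ℝ) : EReal) := by
  have hm : Measurable fun x => ENNReal.ofReal (f x) := hf.ennreal_ofReal
  have hlt : ∀ᵐ x ∂(volume : Measure (ι → ℝ)), ENNReal.ofReal (f x) < ⊤ := by simp
  have hint : Integrable (fun x => Real.negMulLog (f x)) (volume : Measure (ι → ℝ)) := by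
    rw [integrable_withDensity_iff_integrable_smul' hm hlt] at hlog
    refine hlog.neg.congr (ae_of_all _ fun x => ?_)
    simp [Real.negMulLog, ENNReal.toReal_ofReal (hpos x)]
  have hval : ∫ x, Real.negMulLog (f x) = -∫ x, Real.log (f x)
      ∂((volume : Measure (ι → ℝ)).withDensity fun x => ENNReal.ofReal (f x)) := by
    rw [integral_withDensity_eq_integral_toReal_smul hm hlt, ← integral_neg]
    refine integral_congr_ae (ae_of_all _ fun x => ?_)
    simp [Real.negMulLog, ENNReal.toReal_ofReal (hpos x)]
  have hrn : ∀ᵐ x ∂(volume : Measure (ι → ℝ)),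
      (((volume : Measure (ι → ℝ)).withDensity fun x => ENNReal.ofReal (f x)).rnDeriv
        volume x).toReal = f x := by
    filter_upwards [Measure.rnDeriv_withDensity volume hm] with x hx
    rw [hx, ENNReal.toReal_ofReal (hpos x)]
  unfold differentialEntropy
  rw [if_pos (withDensity_absolutelyContinuous _ _)]
  have h1 := lintegral_congr_ae (hrn.mono fun x hx =>
    congrArg (fun t => ENNReal.ofReal (Real.negMulLog t)) hx)
  have h2 := lintegral_congr_ae (hrn.mono fun x hx =>
    congrArg (fun t => ENNReal.ofReal (-Real.negMulLog t)) hx)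
  beta_reduce at h1 h2
  rw [h1, h2, ← hval, integral_eq_lintegral_pos_part_sub_lintegral_neg_part hint, EReal.coe_sub]
  have f1 := hint.lintegral_lt_top
  have f2 : ∫⁻ x, ENNReal.ofReal (-Real.negMulLog (f x)) < ⊤ := hint.neg.lintegral_lt_top
  rw [EReal.coe_ennreal_toReal f1.ne, EReal.coe_ennreal_toReal f2.ne]

/-- The standard Gaussian density on `ℝ^ι`. -/
noncomputable def stdGaussianDensity (x : ι → ℝ) : ℝ := ∏ i, gaussianPDFReal 0 1 (x i)

theorem measurable_stdGaussianDensity : Measurable (stdGaussianDensity : (ι → ℝ) → ℝ) :=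
  Finset.measurable_prod _ fun i _ => (measurable_gaussianPDFReal 0 1).comp (measurable_pi_apply i)

theorem stdGaussianDensity_pos (x : ι → ℝ) : 0 < stdGaussianDensity x :=
  Finset.prod_pos fun i _ => gaussianPDFReal_pos 0 1 (x i) one_ne_zero

theorem pi_gaussianReal_eq_withDensity :
    Measure.pi (fun _ : ι => gaussianReal 0 1) =
      volume.withDensity fun x => ENNReal.ofReal (stdGaussianDensity x) := by
  refine Measure.pi_eq fun s hs => ?_
  rw [withDensity_apply _ (MeasurableSet.univ_pi hs), volume_pi, Measure.restrict_pi_pi,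
    ← ofReal_integral_eq_lintegral_ofReal]
  · unfold stdGaussianDensity
    rw [integral_fintype_prod_eq_prod (fun _ => gaussianPDFReal 0 1), ENNReal.ofReal_prod_of_nonneg]
    · refine Finset.prod_congr rfl fun i _ => ?_
      rw [gaussianReal_apply_eq_integral 0 one_ne_zero]
    · exact fun i _ => integral_nonneg fun x => gaussianPDFReal_nonneg 0 1 x
  · exact Integrable.fintype_prod (f := fun _ => gaussianPDFReal 0 1)
      (μ := fun i => (volume : Measure ℝ).restrict (s i)) fun i => (integrable_gaussianPDFReal 0 1).integrableOn
  · exact ae_of_all _ fun x => (stdGaussianDensity_pos x).le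

theorem log_gaussianPDFReal_zero_one (x : ℝ) :
    Real.log (gaussianPDFReal 0 1 x) = -(Real.log (2 * Real.pi) / 2) - x ^ 2 / 2 := by
  rw [gaussianPDFReal, Real.log_mul (by positivity) (Real.exp_ne_zero _), Real.log_exp,
    Real.log_inv, Real.log_sqrt (by positivity)]
  simp; ring

theorem integrable_sq_gaussianReal : Integrable (fun x : ℝ => x ^ 2) (gaussianReal 0 1) := by
  simpa using (IsGaussian.memLp_two_id (μ := gaussianReal 0 1)).integrable_sq

theorem integral_sq_gaussianReal : ∫ x : ℝ, x ^ 2 ∂(gaussianReal 0 1) = 1 := by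
  have h := variance_id_gaussianReal (μ := 0) (v := 1)
  rw [variance_eq_integral (by fun_prop)] at h
  simpa using h

theorem integrable_log_gaussianPDFReal :
    Integrable (fun x => Real.log (gaussianPDFReal 0 1 x)) (gaussianReal 0 1) := by
  simp_rw [log_gaussianPDFReal_zero_one]
  exact (integrable_const _).sub (integrable_sq_gaussianReal.div_const 2)

theorem integral_log_gaussianPDFReal :
    ∫ x, Real.log (gaussianPDFReal 0 1 x) ∂(gaussianReal 0 1) =
      -(Real.log (2 * Real.pi * Real.exp 1) / 2) := by
  simp_rw [log_gaussianPDFReal_zero_one]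
  rw [integral_sub (integrable_const _) (integrable_sq_gaussianReal.div_const 2),
    integral_div, integral_sq_gaussianReal, Real.log_mul (by positivity) (Real.exp_ne_zero _)]
  simp; ring

theorem integrable_log_stdGaussianDensity :
    Integrable (fun x : ι → ℝ => Real.log (stdGaussianDensity x))
      (Measure.pi fun _ => gaussianReal 0 1) := by
  have h : (fun x : ι → ℝ => Real.log (stdGaussianDensity x)) =
      fun x => ∑ i, Real.log (gaussianPDFReal 0 1 (x i)) := by
    funext x
    exact Real.log_prod fun i _ => (gaussianPDFReal_pos 0 1 (x i) one_ne_zero).ne'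
  rw [h]
  exact integrable_finsetSum _ fun i _ =>
    integrable_comp_eval (μ := fun _ : ι => gaussianReal 0 1) integrable_log_gaussianPDFReal

theorem integral_log_stdGaussianDensity :
    ∫ x : ι → ℝ, Real.log (stdGaussianDensity x) ∂(Measure.pi fun _ => gaussianReal 0 1) =
      -(Fintype.card ι * (Real.log (2 * Real.pi * Real.exp 1) / 2)) := by
  have h : (fun x : ι → ℝ => Real.log (stdGaussianDensity x)) =
      fun x => ∑ i, Real.log (gaussianPDFReal 0 1 (x i)) := by
    funext x
    exact Real.log_prod fun i _ => (gaussianPDFReal_pos 0 1 (x i) one_ne_zero).ne'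
  rw [h, integral_finsetSum _ fun i _ =>
    integrable_comp_eval (μ := fun _ : ι => gaussianReal 0 1) integrable_log_gaussianPDFReal]
  have hi : ∀ i : ι, ∫ x : ι → ℝ, Real.log (gaussianPDFReal 0 1 (x i))
      ∂(Measure.pi fun _ => gaussianReal 0 1) = -(Real.log (2 * Real.pi * Real.exp 1) / 2) := by
    intro i
    rw [← integral_log_gaussianPDFReal]
    exact integral_comp_eval (μ := fun _ : ι => gaussianReal 0 1)
      integrable_log_gaussianPDFReal.aestronglyMeasurable
  simp [hi]

variable [DecidableEq ι]

theorem map_toLin'_pi_gaussianReal {A : Matrix ι ι ℝ} (hA : A.det ≠ 0) :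
    (Measure.pi fun _ : ι => gaussianReal 0 1).map (Matrix.toLin' A) =
      volume.withDensity fun y =>
        ENNReal.ofReal (|A.det|⁻¹ * stdGaussianDensity (Matrix.toLin' A⁻¹ y)) := by
  have hc : ∀ B : Matrix ι ι ℝ, Measurable (Matrix.toLin' B) := fun B =>
    (LinearMap.continuous_on_pi _).measurable
  have hinv : ∀ x, Matrix.toLin' A⁻¹ (Matrix.toLin' A x) = x := fun x => by
    rw [← LinearMap.comp_apply, ← Matrix.toLin'_mul, Matrix.nonsing_inv_mul _ hA.isUnit]; simp
  have hdens : Measurable fun y : ι → ℝ =>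
      ENNReal.ofReal (stdGaussianDensity (Matrix.toLin' A⁻¹ y)) :=
    (measurable_stdGaussianDensity.comp (hc _)).ennreal_ofReal
  have hvol := Real.map_matrix_volume_pi_eq_smul_volume_pi hA
  rw [pi_gaussianReal_eq_withDensity]
  ext s hs
  rw [Measure.map_apply (hc A) hs, withDensity_apply _ (hc A hs), withDensity_apply _ hs]
  have h1 : ∫⁻ x in Matrix.toLin' A ⁻¹' s, ENNReal.ofReal (stdGaussianDensity x) =
      ∫⁻ y in s, ENNReal.ofReal (stdGaussianDensity (Matrix.toLin' A⁻¹ y))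
        ∂(volume.map (Matrix.toLin' A)) := by
    rw [setLIntegral_map hs hdens (hc A)]
    simp only [hinv]
  rw [h1, hvol, Measure.restrict_smul, lintegral_smul_measure, smul_eq_mul,
    ← lintegral_const_mul _ hdens]
  refine lintegral_congr fun y => ?_
  rw [abs_inv, ENNReal.ofReal_mul (by positivity)]

/-- Pulled back along `A`, the log density is the standard one shifted by the constant `-log |det
A|`, so the entropy is computed under the product measure. -/
theorem differentialEntropy_map_toLin' {A : Matrix ι ι ℝ} (hA : A.det ≠ 0) :
    differentialEntropy ((Measure.pi fun _ : ι => gaussianReal 0 1).map (Matrix.toLin' A)) =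
      ((Fintype.card ι * (Real.log (2 * Real.pi * Real.exp 1) / 2) + Real.log |A.det| : ℝ) :
        EReal) := by
  have hc : ∀ B : Matrix ι ι ℝ, Measurable (Matrix.toLin' B) := fun B =>
    (LinearMap.continuous_on_pi _).measurable
  have hinv : ∀ x, Matrix.toLin' A⁻¹ (Matrix.toLin' A x) = x := fun x => by
    rw [← LinearMap.comp_apply, ← Matrix.toLin'_mul, Matrix.nonsing_inv_mul _ hA.isUnit]; simp
  have hfm : Measurable fun y : ι → ℝ => |A.det|⁻¹ * stdGaussianDensity (Matrix.toLin' A⁻¹ y) :=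
    (measurable_stdGaussianDensity.comp (hc _)).const_mul _
  have hlog : ∀ x, Real.log (|A.det|⁻¹ * stdGaussianDensity
      (Matrix.toLin' A⁻¹ (Matrix.toLin' A x))) =
      -Real.log |A.det| + Real.log (stdGaussianDensity x) := fun x => by
    rw [hinv, Real.log_mul (by positivity) (stdGaussianDensity_pos x).ne', Real.log_inv]
  have hprob := Measure.isProbabilityMeasure_map
    (μ := Measure.pi fun _ : ι => gaussianReal 0 1) (hc A).aemeasurable
  have hint : Integrable (fun y => Real.log (|A.det|⁻¹ * stdGaussianDensity (Matrix.toLin' A⁻¹ y)))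
      ((Measure.pi fun _ : ι => gaussianReal 0 1).map (Matrix.toLin' A)) := by
    rw [integrable_map_measure hfm.log.aestronglyMeasurable (hc A).aemeasurable]
    simp only [Function.comp_def, hlog]
    exact (integrable_const _).add integrable_log_stdGaussianDensity
  have hval : ∫ y, Real.log (|A.det|⁻¹ * stdGaussianDensity (Matrix.toLin' A⁻¹ y))
      ∂((Measure.pi fun _ : ι => gaussianReal 0 1).map (Matrix.toLin' A)) =
      -(Fintype.card ι * (Real.log (2 * Real.pi * Real.exp 1) / 2) + Real.log |A.det|) := by
    rw [integral_map (hc A).aemeasurable hfm.log.aestronglyMeasurable]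
    simp only [hlog]
    rw [integral_add (integrable_const _) integrable_log_stdGaussianDensity,
      integral_log_stdGaussianDensity]
    simp
  rw [map_toLin'_pi_gaussianReal hA] at hint hval hprob ⊢
  rw [differentialEntropy_withDensity hfm
    (fun y => mul_nonneg (by positivity) (stdGaussianDensity_pos _).le) hint, hval, neg_neg]

open scoped MatrixOrder in
-- A Gaussian law is determined by its mean and covariance. The comparison with
-- `multivariateGaussian` takes place on `EuclideanSpace`, hence the passage through `WithLp.toLp`
-- and back.
theorem eq_map_toLin'_sqrt_of_isGaussian {ν : Measure (ι → ℝ)} [IsGaussian ν]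
    {G : Matrix ι ι ℝ} (hG : G.PosSemidef) (hmean : ∀ i, ∫ x, x i ∂ν = 0)
    (hcov : ∀ i j, cov[fun x => x i, fun x => x j; ν] = G i j) :
    ν = (Measure.pi fun _ : ι => gaussianReal 0 1).map (Matrix.toLin' (CFC.sqrt G)) := by
  have hgauss : IsGaussian (ν.map (WithLp.toLp 2)) :=
    (HasGaussianLaw.toLp_pi (X := fun i (x : ι → ℝ) => x i) 2
      IsGaussian.hasGaussianLaw_id).isGaussian_map
  have hto : Measurable (WithLp.toLp 2 : (ι → ℝ) → EuclideanSpace ℝ ι) := by fun_prop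
  have hof : Measurable (WithLp.ofLp : EuclideanSpace ℝ ι → ι → ℝ) := by fun_prop
  have hmap : ν.map (WithLp.toLp 2) = multivariateGaussian 0 G := by
    apply IsGaussian.ext
    · simp only [id_eq, integral_id_multivariateGaussian]
      ext i
      have h1 : ∫ x : EuclideanSpace ℝ ι, x i ∂(ν.map (WithLp.toLp 2)) =
          (∫ x : EuclideanSpace ℝ ι, x ∂(ν.map (WithLp.toLp 2))) i :=
        (EuclideanSpace.proj i : EuclideanSpace ℝ ι →L[ℝ] ℝ).integral_comp_comm
          (IsGaussian.integrable_id (μ := ν.map (WithLp.toLp 2)))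
      rw [← h1, integral_map hto.aemeasurable (by fun_prop)]
      simpa using hmean i
    · rw [← ContinuousLinearMap.toBilinForm_inj]
      refine LinearMap.BilinForm.ext_basis (EuclideanSpace.basisFun ι ℝ).toBasis fun i j => ?_
      rw [ContinuousLinearMap.toBilinForm_apply, ContinuousLinearMap.toBilinForm_apply,
        covarianceBilin_apply_eq_cov IsGaussian.memLp_two_id, covariance_map,
        covarianceBilin_multivariateGaussian hG]
      · have hi : ∀ i : ι, (fun u : EuclideanSpace ℝ ι =>
            inner ℝ ((EuclideanSpace.basisFun ι ℝ).toBasis i) u) ∘ WithLp.toLp 2 =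
            fun x : ι → ℝ => x i := by
          intro i; ext x; simp [PiLp.inner_apply]
        rw [hi, hi, hcov]
        simp
      any_goals exact Measurable.aestronglyMeasurable (by fun_prop)
      exact hto.aemeasurable
  have hν : ν = (ν.map (WithLp.toLp 2)).map WithLp.ofLp := by
    rw [Measure.map_map hof hto]
    simp [Function.comp_def]
  have hcl : Measurable fun x : EuclideanSpace ℝ ι =>
      (0 : EuclideanSpace ℝ ι) + Matrix.toEuclideanCLM (𝕜 := ℝ) (CFC.sqrt G) x := by fun_prop
  rw [hν, hmap, multivariateGaussian, ← map_pi_eq_stdGaussian, Measure.map_map hcl hto,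
    Measure.map_map hof (hcl.comp hto)]
  congr 1
  ext x i
  simp

open scoped MatrixOrder in
/-- The differential entropy of a centered Gaussian law with positive definite covariance. -/
theorem differentialEntropy_of_isGaussian {ν : Measure (ι → ℝ)} [IsGaussian ν]
    {G : Matrix ι ι ℝ} (hG : G.PosDef) (hmean : ∀ i, ∫ x, x i ∂ν = 0)
    (hcov : ∀ i j, cov[fun x => x i, fun x => x j; ν] = G i j) :
    differentialEntropy ν =
      ((Fintype.card ι * (Real.log (2 * Real.pi * Real.exp 1) / 2) + Real.log G.det / 2 : ℝ) :
        EReal) := by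
  have hsq : (CFC.sqrt G).det = √G.det := by
    simpa using hG.posSemidef.det_sqrt
  have hpos : 0 < √G.det := Real.sqrt_pos.2 hG.det_pos
  rw [eq_map_toLin'_sqrt_of_isGaussian hG.posSemidef hmean hcov, differentialEntropy_map_toLin'
    (by rw [hsq]; exact hpos.ne'), hsq, abs_of_pos hpos, Real.log_sqrt hG.det_pos.le]

end GaussianEntropy

/-! ### Uniqueness of Fourier coefficients on the torus. -/

section Torus

variable {d : Type*} [Fintype d]

/-- A finite measure on the torus is determined by its Fourier coefficients. -/
theorem UnitAddTorus.measure_ext_of_integral_mFourier {μ ν : Measure (UnitAddTorus d)}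
    [IsFiniteMeasure μ] [IsFiniteMeasure ν]
    (h : ∀ k : d → ℤ, ∫ x, mFourier k x ∂μ = ∫ x, mFourier k x ∂ν) : μ = ν := by
  -- Trigonometric polynomials form a star subalgebra separating points, which determines finite
  -- measures on a Polish space.
  let A : StarSubalgebra ℂ (BoundedContinuousFunction (UnitAddTorus d) ℂ) :=
    (mFourierSubalgebra d).comap (BoundedContinuousFunction.toContinuousMapStarₐ ℂ)
  refine ext_of_forall_mem_subalgebra_integral_eq_of_polish (A := A) ?_ ?_
  · intro x y hxy
    obtain ⟨_, ⟨f, hf, rfl⟩, hne⟩ := mFourierSubalgebra_separatesPoints (d := d) hxy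
    refine ⟨f, ⟨f, ⟨BoundedContinuousFunction.mkOfCompact f, ?_, ?_⟩, rfl⟩, hne⟩
    · exact hf
    · ext; rfl
  · intro g hg
    have hspan : (g : C(UnitAddTorus d, ℂ)) ∈ Submodule.span ℂ (Set.range (mFourier (d := d))) := by
      rw [← mFourierSubalgebra_coe]
      exact hg
    have key : ∀ f ∈ Submodule.span ℂ (Set.range (mFourier (d := d))),
        ∫ x, f x ∂μ = ∫ x, f x ∂ν := by
      intro f hf
      induction hf using Submodule.span_induction with
      | mem f hf => obtain ⟨k, rfl⟩ := hf; exact h k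
      | zero => simp
      | add f g _ _ hf hg =>
        have hi : ∀ (f : C(UnitAddTorus d, ℂ)) (ρ : Measure (UnitAddTorus d)) [IsFiniteMeasure ρ],
            Integrable f ρ := fun f ρ _ => f.continuous.integrable_of_hasCompactSupport
              (HasCompactSupport.of_compactSpace _)
        simp only [ContinuousMap.add_apply]
        rw [integral_add (hi f μ) (hi g μ), integral_add (hi f ν) (hi g ν), hf, hg]
      | smul c f _ hf =>
        simp only [ContinuousMap.smul_apply]
        rw [integral_smul, integral_smul, hf]
    exact key _ hspan

end Torus

/-! ### Characters of the frequency space and their descent to the torus. -/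

section FreqChar

variable {d : ℕ} (b : Module.Basis (Fin d) ℝ (EuclideanSpace ℝ (Fin d)))

theorem freqChar_zero (ξ : EuclideanSpace ℝ (Fin d)) : freqChar b 0 ξ = 1 := by
  simp [freqChar]

theorem freqChar_add_lag (k l : Fin d → ℤ) (ξ : EuclideanSpace ℝ (Fin d)) :
    freqChar b (k + l) ξ = freqChar b k ξ * freqChar b l ξ := by
  simp only [freqChar, ← Complex.exp_add, ← mul_add, ← Complex.ofReal_add,
    ← Finset.sum_add_distrib, Pi.add_apply, Int.cast_add, add_mul]

theorem freqChar_add (k : Fin d → ℤ) (ξ η : EuclideanSpace ℝ (Fin d)) :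
    freqChar b k (ξ + η) = freqChar b k ξ * freqChar b k η := by
  simp only [freqChar, ← Complex.exp_add, ← mul_add, ← Complex.ofReal_add,
    ← Finset.sum_add_distrib, map_add, Finsupp.add_apply]

theorem conj_freqChar (k : Fin d → ℤ) (ξ : EuclideanSpace ℝ (Fin d)) :
    (starRingEnd ℂ) (freqChar b k ξ) = freqChar b (-k) ξ := by
  simp [freqChar, ← Complex.exp_conj, Complex.conj_ofNat]

theorem norm_freqChar (k : Fin d → ℤ) (ξ : EuclideanSpace ℝ (Fin d)) :
    ‖freqChar b k ξ‖ = 1 := by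
  have : freqChar b k ξ = Complex.exp (((2 * Real.pi * ∑ i, (k i : ℝ) * b.repr ξ i : ℝ) : ℂ)
      * Complex.I) := by
    simp only [freqChar]; congr 1; push_cast; ring
  rw [this, Complex.norm_exp_ofReal_mul_I]

theorem continuous_repr (i : Fin d) : Continuous fun ξ => b.repr ξ i :=
  (b.coord i).continuous_of_finiteDimensional

theorem continuous_freqChar (k : Fin d → ℤ) : Continuous (freqChar b k) := by
  unfold freqChar
  have := continuous_repr b
  fun_prop

theorem freqChar_vadd (k : Fin d → ℤ) (γ : Submodule.span ℤ (Set.range b))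
    (ξ : EuclideanSpace ℝ (Fin d)) : freqChar b k (γ +ᵥ ξ) = freqChar b k ξ := by
  have h1 : freqChar b k (γ : EuclideanSpace ℝ (Fin d)) = 1 := by
    have hr := (b.mem_span_iff_repr_mem ℤ (γ : EuclideanSpace ℝ (Fin d))).1 γ.2
    choose m hm using hr
    simp only [freqChar, ← hm]
    rw [Complex.exp_eq_one_iff]
    refine ⟨∑ i, k i * m i, ?_⟩
    simp
    ring
  rw [Submodule.vadd_def, vadd_eq_add, freqChar_add, h1, one_mul]

/-- The coordinates of a frequency modulo the frequency periods. -/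
noncomputable def freqToTorus (ξ : EuclideanSpace ℝ (Fin d)) : UnitAddTorus (Fin d) :=
  fun i => ((b.repr ξ i : ℝ) : UnitAddCircle)

theorem continuous_freqToTorus : Continuous (freqToTorus b) :=
  continuous_pi fun i => (AddCircle.continuous_mk' 1).comp (continuous_repr b i)

theorem mFourier_freqToTorus (k : Fin d → ℤ) (ξ : EuclideanSpace ℝ (Fin d)) :
    UnitAddTorus.mFourier k (freqToTorus b ξ) = freqChar b k ξ := by
  simp only [UnitAddTorus.mFourier, ContinuousMap.coe_mk, freqToTorus, fourier_coe_apply, freqChar,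
    ← Complex.exp_sum]
  congr 1
  push_cast
  rw [Finset.mul_sum]
  exact Finset.sum_congr rfl fun i _ => by simp; ring

theorem sub_mem_of_freqToTorus_eq {ξ η : EuclideanSpace ℝ (Fin d)}
    (h : freqToTorus b ξ = freqToTorus b η) : ξ - η ∈ Submodule.span ℤ (Set.range b) := by
  rw [b.mem_span_iff_repr_mem ℤ]
  intro i
  have hi : ((b.repr ξ i : ℝ) : UnitAddCircle) = (b.repr η i : ℝ) := congrFun h i
  rw [← sub_eq_zero, ← AddCircle.coe_sub, AddCircle.coe_eq_zero_iff] at hi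
  obtain ⟨n, hn⟩ := hi
  exact ⟨n, by simpa using hn⟩

/-- Coordinates in a half-open unit cube choose the representative. Measurability of the section is
what makes images of saturated sets in the torus measurable. -/
theorem exists_measurable_section_freqToTorus :
    ∃ s : UnitAddTorus (Fin d) → EuclideanSpace ℝ (Fin d),
      Measurable s ∧ ∀ t, freqToTorus b (s t) = t := by
  refine ⟨fun t => ∑ i, (UnitAddTorus.measurableEquivPiIoc (0 : Fin d → ℝ) t).1 i • b i, ?_, ?_⟩
  · have h := (measurable_subtype_coe.comp
      (UnitAddTorus.measurableEquivPiIoc (0 : Fin d → ℝ)).measurable)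
    exact Finset.measurable_sum _ fun i _ => ((measurable_pi_apply i).comp h).smul_const (b i)
  · intro t
    have h := (UnitAddTorus.measurableEquivPiIoc (0 : Fin d → ℝ)).symm_apply_apply t
    rw [UnitAddTorus.coe_symm_measurableEquivPiIoc_apply] at h
    conv_rhs => rw [← h]
    funext i
    simp only [freqToTorus, b.repr_sum_self]

end FreqChar

/-! ### Fourier analysis on a frequency domain. -/

section FrequencyDomain

open scoped Pointwise

instance vaddInvariantMeasure_submodule_int {E : Type*} [AddCommGroup E] [MeasurableSpace E]
    (μ : Measure E) [μ.IsAddLeftInvariant] [MeasurableAdd E] (L : Submodule ℤ E) :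
    VAddInvariantMeasure L E μ :=
  ⟨fun c s _ => measure_preimage_add μ (c : E) s⟩

variable {d : ℕ} {b : Module.Basis (Fin d) ℝ (EuclideanSpace ℝ (Fin d))}
  {F : Set (EuclideanSpace ℝ (Fin d))}

theorem IsFrequencyDomain.measure_eq (hF : IsFrequencyDomain b F) :
    volume F = volume (ZSpan.fundamentalDomain b) :=
  IsAddFundamentalDomain.measure_eq hF (ZSpan.isAddFundamentalDomain b volume)

theorem IsFrequencyDomain.measure_ne_top (hF : IsFrequencyDomain b F) : volume F ≠ ⊤ := by
  rw [hF.measure_eq]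
  exact (ZSpan.fundamentalDomain_isBounded b).measure_lt_top.ne

theorem IsFrequencyDomain.measureReal_pos (hF : IsFrequencyDomain b F) : 0 < volume.real F := by
  refine ENNReal.toReal_pos ?_ hF.measure_ne_top
  rw [hF.measure_eq]
  exact ZSpan.measure_fundamentalDomain_ne_zero b

theorem IsFrequencyDomain.isFiniteMeasure (hF : IsFrequencyDomain b F) :
    IsFiniteMeasure (volume.restrict F) :=
  isFiniteMeasure_restrict.2 hF.measure_ne_top

/-- The translate of `F` by `v` is again a fundamental domain, so it gives the same integral of the
periodic character; but `v`, half a period of the character along `b i`, multiplies the character by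
`-1`. -/
theorem IsFrequencyDomain.setIntegral_freqChar_of_ne (hF : IsFrequencyDomain b F)
    {k : Fin d → ℤ} (hk : k ≠ 0) : ∫ ξ in F, freqChar b k ξ = 0 := by
  obtain ⟨i, hi⟩ := Function.ne_iff.1 hk
  have hi' : (k i : ℝ) ≠ 0 := by exact_mod_cast hi
  let v : EuclideanSpace ℝ (Fin d) := (1 / (2 * (k i : ℝ))) • b i
  have hv : freqChar b k v = -1 := by
    have : ∑ j, (k j : ℝ) * b.repr v j = 1 / 2 := by
      rw [Finset.sum_eq_single i]
      · simp [v]; field_simp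
      · intro j _ hj; simp [v, hj.symm]
      · simp
    rw [freqChar, this, ← Complex.exp_pi_mul_I]
    congr 1; push_cast; ring
  have h1 : ∫ ξ in (v +ᵥ F), freqChar b k ξ = ∫ ξ in F, freqChar b k ξ :=
    (hF.vadd_of_comm v).setIntegral_eq hF (freqChar_vadd b k)
  have h2 : ∫ ξ in (v +ᵥ F), freqChar b k ξ = ∫ ξ in F, freqChar b k (v +ᵥ ξ) :=
    (measurePreserving_vadd v volume).setIntegral_image_emb (measurableEmbedding_const_vadd v) _ F
  simp only [vadd_eq_add, freqChar_add, hv] at h2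
  rw [h1, integral_const_mul] at h2
  have : (2 : ℂ) * ∫ ξ in F, freqChar b k ξ = 0 := by linear_combination h2
  simpa using this

theorem IsFrequencyDomain.setIntegral_freqChar (hF : IsFrequencyDomain b F)
    (k : Fin d → ℤ) : ∫ ξ in F, freqChar b k ξ = if k = 0 then (volume.real F : ℂ) else 0 := by
  split_ifs with h
  · subst h
    simp [freqChar_zero]
  · exact hF.setIntegral_freqChar_of_ne h

theorem normSq_sum_freqChar {ι : Type*} [Fintype ι] (t : ι → Fin d → ℤ) (x : ι → ℝ)
    (ξ : EuclideanSpace ℝ (Fin d)) :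
    ((‖∑ i, (x i : ℂ) * freqChar b (t i) ξ‖ ^ 2 : ℝ) : ℂ) =
      ∑ i, ∑ j, (x i : ℂ) * x j * freqChar b (t i - t j) ξ := by
  push_cast
  rw [← Complex.mul_conj', map_sum, Finset.sum_mul_sum]
  refine Finset.sum_congr rfl fun i _ => Finset.sum_congr rfl fun j _ => ?_
  rw [map_mul, conj_freqChar, Complex.conj_ofReal, sub_eq_add_neg, freqChar_add_lag]
  ring

theorem integrableOn_mul_freqChar {S : EuclideanSpace ℝ (Fin d) → ℝ} (hS : IntegrableOn S F)
    (k : Fin d → ℤ) : IntegrableOn (fun ξ => (S ξ : ℂ) * freqChar b k ξ) F := by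
  refine Integrable.mul_bdd (c := 1) (hS.ofReal) (continuous_freqChar b k).aestronglyMeasurable
    (ae_of_all _ fun ξ => (norm_freqChar b k ξ).le)

theorem integral_mul_normSq_sum_freqChar {ι : Type*} [Fintype ι] {t : ι → Fin d → ℤ}
    {S : EuclideanSpace ℝ (Fin d) → ℝ} (hS : IntegrableOn S F) (x : ι → ℝ) :
    ((∫ ξ in F, S ξ * ‖∑ i, (x i : ℂ) * freqChar b (t i) ξ‖ ^ 2 : ℝ) : ℂ) =
      ∑ i, ∑ j, (x i : ℂ) * x j * ∫ ξ in F, (S ξ : ℂ) * freqChar b (t i - t j) ξ := by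
  rw [← integral_complex_ofReal]
  simp only [Complex.ofReal_mul, normSq_sum_freqChar]
  have h : ∀ ξ, (S ξ : ℂ) * ∑ i, ∑ j, (x i : ℂ) * x j * freqChar b (t i - t j) ξ =
      ∑ i, ∑ j, (x i : ℂ) * x j * ((S ξ : ℂ) * freqChar b (t i - t j) ξ) := fun ξ => by
    simp only [Finset.mul_sum]
    exact Finset.sum_congr rfl fun i _ => Finset.sum_congr rfl fun j _ => by ring
  simp only [h]
  rw [integral_finsetSum _ fun i _ => integrable_finsetSum _ fun j _ =>
    (integrableOn_mul_freqChar hS _).const_mul _]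
  refine Finset.sum_congr rfl fun i _ => ?_
  rw [integral_finsetSum _ fun j _ => (integrableOn_mul_freqChar hS _).const_mul _]
  simp only [integral_const_mul]

/-- The quadratic form of an almost everywhere positive spectral density is positive definite. -/
theorem IsFrequencyDomain.integral_mul_normSq_pos (hF : IsFrequencyDomain b F)
    {ι : Type*} [Fintype ι] {t : ι → Fin d → ℤ} (ht : Function.Injective t)
    {S : EuclideanSpace ℝ (Fin d) → ℝ} (hS : IntegrableOn S F)
    (hpos : ∀ᵐ ξ ∂(volume.restrict F), 0 < S ξ) {x : ι → ℝ} (hx : x ≠ 0) :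
    0 < ∫ ξ in F, S ξ * ‖∑ i, (x i : ℂ) * freqChar b (t i) ξ‖ ^ 2 := by
  have := hF.isFiniteMeasure
  have hcont : Continuous fun ξ => ‖∑ i, (x i : ℂ) * freqChar b (t i) ξ‖ ^ 2 := by
    have := continuous_freqChar b
    fun_prop
  have hbd : ∀ ξ, ‖‖∑ i, (x i : ℂ) * freqChar b (t i) ξ‖ ^ 2‖ ≤ (∑ i, |x i|) ^ 2 := fun ξ => by
    rw [norm_pow, norm_norm]
    refine pow_le_pow_left₀ (norm_nonneg _) ((norm_sum_le _ _).trans (le_of_eq ?_)) 2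
    simp [norm_freqChar]
  have hnn : 0 ≤ᵐ[volume.restrict F] fun ξ =>
      S ξ * ‖∑ i, (x i : ℂ) * freqChar b (t i) ξ‖ ^ 2 := by
    filter_upwards [hpos] with ξ hξ
    exact mul_nonneg hξ.le (sq_nonneg _)
  have hint : Integrable (fun ξ => S ξ * ‖∑ i, (x i : ℂ) * freqChar b (t i) ξ‖ ^ 2)
      (volume.restrict F) :=
    Integrable.mul_bdd hS hcont.aestronglyMeasurable (ae_of_all _ hbd)
  refine lt_of_le_of_ne (integral_nonneg_of_ae hnn) fun h0 => ?_
  have hz := (integral_eq_zero_iff_of_nonneg_ae hnn hint).1 h0.symm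
  -- As `S > 0` a.e., the trigonometric polynomial vanishes a.e., so the weight may be replaced by
  -- `1`; orthogonality then evaluates the integral as `(∑ x i ^ 2) * vol F`.
  have hz' : ∫ ξ in F, (1 : ℝ) * ‖∑ i, (x i : ℂ) * freqChar b (t i) ξ‖ ^ 2 = 0 := by
    refine integral_eq_zero_of_ae ?_
    filter_upwards [hz, hpos] with ξ h1 h2
    simpa [h2.ne'] using h1
  have h1 := integral_mul_normSq_sum_freqChar (b := b) (F := F) (t := t) (S := fun _ => 1)
    (integrable_const _) x
  rw [hz'] at h1
  simp only [Complex.ofReal_one, one_mul, hF.setIntegral_freqChar] at h1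
  have ht' : ∀ i j, t i - t j = 0 ↔ i = j := fun i j => by rw [sub_eq_zero, ht.eq_iff]
  classical
  simp only [ht'] at h1
  simp only [mul_ite, mul_zero, Finset.sum_ite_eq, Finset.mem_univ, if_true,
    ← Finset.sum_mul] at h1
  have h2 : (0 : ℝ) = (∑ i, x i * x i) * volume.real F := by exact_mod_cast h1
  have h3 : ∑ i, x i * x i = 0 := by
    simpa [hF.measureReal_pos.ne'] using h2.symm
  rw [Finset.sum_eq_zero_iff_of_nonneg fun i _ => mul_self_nonneg _] at h3
  exact hx (funext fun i => by simpa using h3 i (Finset.mem_univ i))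

/-- The union of the translates of a set by the frequency periods. -/
def periodSaturation (b : Module.Basis (Fin d) ℝ (EuclideanSpace ℝ (Fin d)))
    (U : Set (EuclideanSpace ℝ (Fin d))) : Set (EuclideanSpace ℝ (Fin d)) :=
  ⋃ γ : Submodule.span ℤ (Set.range b), γ +ᵥ U

theorem measurableSet_periodSaturation {U : Set (EuclideanSpace ℝ (Fin d))}
    (hU : MeasurableSet U) : MeasurableSet (periodSaturation b U) :=
  MeasurableSet.iUnion fun γ => hU.const_vadd γ

theorem subset_periodSaturation (U : Set (EuclideanSpace ℝ (Fin d))) :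
    U ⊆ periodSaturation b U := fun ξ hξ =>
  Set.mem_iUnion.2 ⟨0, by simpa using hξ⟩

theorem mem_periodSaturation_of_sub_mem {U : Set (EuclideanSpace ℝ (Fin d))}
    {ξ η : EuclideanSpace ℝ (Fin d)} (h : ξ - η ∈ Submodule.span ℤ (Set.range b))
    (hη : η ∈ periodSaturation b U) : ξ ∈ periodSaturation b U := by
  obtain ⟨γ, ζ, hζ, rfl⟩ := Set.mem_iUnion.1 hη
  refine Set.mem_iUnion.2 ⟨⟨_, h⟩ + γ, ζ, hζ, ?_⟩
  simp only [vadd_eq_add, Submodule.coe_add]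
  abel

/-- Each nonzero period moves `F` off itself up to a null set, and there are countably many periods.
-/
theorem IsFrequencyDomain.periodSaturation_ae (hF : IsFrequencyDomain b F)
    {U : Set (EuclideanSpace ℝ (Fin d))} (hU : U ⊆ F) :
    periodSaturation b U =ᵐ[volume.restrict F] U := by
  have hnull : ∀ᵐ ξ ∂(volume.restrict F), ∀ γ : Submodule.span ℤ (Set.range b), γ ≠ 0 →
      ξ ∉ (γ +ᵥ F) ∩ F := by
    rw [ae_all_iff]
    intro γ
    by_cases hγ : γ = 0
    · simp [hγ]
    have h := hF.aedisjoint hγ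
    simp only [Function.onFun, zero_vadd, AEDisjoint] at h
    have h' := Measure.absolutelyContinuous_of_le (Measure.restrict_le_self (s := F)) h
    filter_upwards [measure_eq_zero_iff_ae_notMem.1 h'] with ξ hξ _ using hξ
  have hmem : ∀ᵐ ξ ∂(volume.restrict F), ξ ∈ F :=
    ae_restrict_mem₀ hF.nullMeasurableSet
  filter_upwards [hnull, hmem] with ξ h1 h2
  refine propext ⟨fun h => ?_, fun h => subset_periodSaturation U h⟩
  obtain ⟨γ, hγ⟩ := Set.mem_iUnion.1 h
  by_cases h0 : γ = 0
  · subst h0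
    rw [zero_vadd] at hγ
    exact hγ
  · exact absurd ⟨Set.vadd_set_mono hU hγ, h2⟩ (h1 γ h0)

/-- Finite measures on a frequency domain with the same Fourier coefficients coincide. -/
theorem IsFrequencyDomain.measure_ext (hF : IsFrequencyDomain b F)
    {μ ν : Measure (EuclideanSpace ℝ (Fin d))} [IsFiniteMeasure μ] [IsFiniteMeasure ν]
    (hμ : μ ≪ volume.restrict F) (hν : ν ≪ volume.restrict F)
    (h : ∀ k, ∫ ξ, freqChar b k ξ ∂μ = ∫ ξ, freqChar b k ξ ∂ν) : μ = ν := by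
  have hq := (continuous_freqToTorus b).measurable
  have hmap : μ.map (freqToTorus b) = ν.map (freqToTorus b) := by
    refine UnitAddTorus.measure_ext_of_integral_mFourier fun k => ?_
    rw [integral_map hq.aemeasurable (by fun_prop), integral_map hq.aemeasurable (by fun_prop)]
    simpa only [mFourier_freqToTorus] using h k
  obtain ⟨s, hs, hsec⟩ := exists_measurable_section_freqToTorus b
  -- A fundamental domain is only null measurable; `F'` is a measurable substitute.
  obtain ⟨F', hF'F, hF'm, hF'ae⟩ := hF.nullMeasurableSet.exists_measurable_subset_ae_eq
  -- A saturated set is the preimage of a measurable subset of the torus, where the two image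
  -- measures agree. Up to a null set, every measurable set is the saturation of its part in `F'`.
  have hsat : ∀ U, MeasurableSet U → μ (periodSaturation b U) = ν (periodSaturation b U) := by
    intro U hU
    have hpre : freqToTorus b ⁻¹' (s ⁻¹' periodSaturation b U) = periodSaturation b U := by
      ext ξ
      refine ⟨fun hξ => ?_, fun hξ => ?_⟩
      · exact mem_periodSaturation_of_sub_mem
          (sub_mem_of_freqToTorus_eq b (hsec (freqToTorus b ξ)).symm) hξ
      · exact mem_periodSaturation_of_sub_mem
          (sub_mem_of_freqToTorus_eq b (hsec (freqToTorus b ξ))) hξ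
    have hm := hs (measurableSet_periodSaturation (b := b) hU)
    rw [← hpre, ← Measure.map_apply hq hm, hmap, Measure.map_apply hq hm]
  ext A hA
  have hAF : (A ∩ F' : Set _) =ᵐ[volume.restrict F] A := by
    have h1 : ∀ᵐ ξ ∂(volume.restrict F), ξ ∈ F := ae_restrict_mem₀ hF.nullMeasurableSet
    have h2 : F' =ᵐ[volume.restrict F] F := ae_restrict_of_ae hF'ae
    filter_upwards [h1, h2] with ξ h1 h2
    have h3 : ξ ∈ F' := h2.mpr h1
    exact propext ⟨fun h => h.1, fun h => ⟨h, h3⟩⟩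
  have hfull := (hF.periodSaturation_ae (Set.inter_subset_right.trans hF'F :
    A ∩ F' ⊆ F)).trans hAF
  rw [← measure_congr (hμ.ae_le hfull), ← measure_congr (hν.ae_le hfull),
    hsat _ (hA.inter hF'm)]

/-- A nonnegative integrable function whose nonconstant Fourier coefficients vanish is flat. -/
theorem IsFrequencyDomain.ae_eq_const_of_integral_eq_zero (hF : IsFrequencyDomain b F)
    {S : EuclideanSpace ℝ (Fin d) → ℝ} (hS : IntegrableOn S F)
    (hnn : ∀ᵐ ξ ∂(volume.restrict F), 0 ≤ S ξ)
    (h : ∀ k, k ≠ 0 → ∫ ξ in F, (S ξ : ℂ) * freqChar b k ξ = 0) :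
    S =ᵐ[volume.restrict F] fun _ => (∫ ξ in F, S ξ) / volume.real F := by
  have := hF.isFiniteMeasure
  set c : ℝ := (∫ ξ in F, S ξ) / volume.real F with hc
  have hc0 : 0 ≤ c := div_nonneg (integral_nonneg_of_ae hnn) measureReal_nonneg
  have hI : ∀ {T : EuclideanSpace ℝ (Fin d) → ℝ}, IntegrableOn T F →
      (∀ᵐ ξ ∂(volume.restrict F), 0 ≤ T ξ) → ∀ k,
      ∫ ξ, freqChar b k ξ ∂((volume.restrict F).withDensity fun ξ => ENNReal.ofReal (T ξ)) =
        ∫ ξ in F, (T ξ : ℂ) * freqChar b k ξ := by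
    intro T hT hT0 k
    rw [integral_withDensity_eq_integral_toReal_smul₀ hT.aemeasurable.ennreal_ofReal (by simp)]
    refine integral_congr_ae ?_
    filter_upwards [hT0] with ξ hξ
    rw [ENNReal.toReal_ofReal hξ, Complex.real_smul]
  have hfin : ∀ {T : EuclideanSpace ℝ (Fin d) → ℝ}, IntegrableOn T F →
      IsFiniteMeasure ((volume.restrict F).withDensity fun ξ => ENNReal.ofReal (T ξ)) := by
    intro T hT
    exact isFiniteMeasure_withDensity_ofReal hT.2
  have hcI : IntegrableOn (fun _ : EuclideanSpace ℝ (Fin d) => c) F := integrable_const _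
  have := hfin hS
  have := hfin hcI
  -- The constant `c` is the mean of `S`, so the zeroth coefficients agree too.
  have heq : ((volume.restrict F).withDensity fun ξ => ENNReal.ofReal (S ξ)) =
      (volume.restrict F).withDensity fun _ => ENNReal.ofReal c := by
    refine hF.measure_ext (withDensity_absolutelyContinuous _ _)
      (withDensity_absolutelyContinuous _ _) fun k => ?_
    rw [hI hS hnn, hI hcI (ae_of_all _ fun _ => hc0), integral_const_mul, hF.setIntegral_freqChar]
    split_ifs with hk
    · subst hk
      simp only [freqChar_zero, mul_one]
      rw [integral_complex_ofReal, ← Complex.ofReal_mul, hc,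
        div_mul_cancel₀ _ hF.measureReal_pos.ne']
    · rw [h k hk, mul_zero]
  have hae := (withDensity_eq_iff_of_sigmaFinite hS.aemeasurable.ennreal_ofReal
    (by fun_prop)).1 heq
  filter_upwards [hae, hnn] with ξ h1 h2
  exact (ENNReal.ofReal_eq_ofReal_iff h2 hc0).1 h1

end FrequencyDomain

/-! ### The determinant bound for a constant diagonal. -/

namespace Matrix

variable {ι : Type*} [Fintype ι] [DecidableEq ι]

/-- The rescaled matrix `P⁻¹ • G` has trace equal to the dimension, so its log determinant is at
most `0`. -/
theorem PosDef.log_det_le_of_diag_eq {G : Matrix ι ι ℝ} (hG : G.PosDef) {P : ℝ} (hP : 0 < P)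
    (hd : ∀ i, G i i = P) : Real.log G.det ≤ Fintype.card ι * Real.log P := by
  have h := (hG.smul (inv_pos.2 hP)).log_det_le_trace_sub_card
  rw [det_smul, Real.log_mul (pow_pos (inv_pos.2 hP) _).ne' hG.det_pos.ne', Real.log_pow,
    Real.log_inv, trace_smul] at h
  have ht : P⁻¹ • G.trace = Fintype.card ι := by
    simp [trace, hd]
    field_simp
  rw [ht] at h
  linarith

theorem PosDef.eq_smul_one_of_log_det_eq {G : Matrix ι ι ℝ} (hG : G.PosDef) {P : ℝ} (hP : 0 < P)
    (hd : ∀ i, G i i = P) (h : Real.log G.det = Fintype.card ι * Real.log P) : G = P • 1 := by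
  have ht : (P⁻¹ • G).trace = Fintype.card ι := by
    simp [trace, hd]
    field_simp
  have h1 : P⁻¹ • G = 1 := (hG.smul (inv_pos.2 hP)).eq_one_of_log_det_eq (by
    rw [det_smul, Real.log_mul (pow_pos (inv_pos.2 hP) _).ne' hG.det_pos.ne', Real.log_pow,
      Real.log_inv, ht, h]
    ring)
  rw [← h1, smul_smul, mul_inv_cancel₀ hP.ne', one_smul]

end Matrix

/-! ### Limits of subadditive type. -/

theorem tendsto_natDiv_div (m : ℕ) :
    Tendsto (fun n : ℕ => ((n / m : ℕ) : ℝ) / n) atTop (𝓝 (m : ℝ)⁻¹) := by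
  have h := (tendsto_nat_floor_mul_div_atTop (R := ℝ) (a := (m : ℝ)⁻¹) (by positivity)).comp
    tendsto_natCast_atTop_atTop
  refine h.congr fun n => ?_
  simp only [Function.comp]
  rw [inv_mul_eq_div, Nat.floor_div_natCast, Nat.floor_natCast]

/-- A form of Fekete's lemma: a sequence asymptotically dominated by each of its values converges
to its infimum. -/
theorem tendsto_iInf_of_eventually_le {w : ℕ → ℝ}
    (h : ∀ m, 1 ≤ m → ∃ v : ℕ → ℝ, Tendsto v atTop (𝓝 (w m)) ∧ ∀ᶠ n in atTop, w n ≤ v n) :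
    Tendsto (fun n => (w n : EReal)) atTop (𝓝 (⨅ m : ℕ, (w (m + 1) : EReal))) := by
  refine tendsto_order.2 ⟨fun a ha => ?_, fun a ha => ?_⟩
  -- The infimum omits index `0`, where the normalization by `n ^ d` degenerates for `d > 0`.
  · filter_upwards [eventually_ge_atTop 1] with n hn
    obtain ⟨m, rfl⟩ := Nat.exists_eq_add_of_le' hn
    exact ha.trans_le (iInf_le _ m)
  · obtain ⟨m, hm⟩ := iInf_lt_iff.1 ha
    obtain ⟨v, hv, hle⟩ := h (m + 1) (by omega)
    have hv' : Tendsto (fun n => (v n : EReal)) atTop (𝓝 (w (m + 1) : EReal)) :=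
      (continuous_coe_real_ereal.tendsto _).comp hv
    filter_upwards [hv'.eventually_lt_const hm, hle] with n h1 h2
    exact (EReal.coe_le_coe_iff.2 h2).trans_lt h1

/-! ### Tiling of cubes and the determinant deficit. -/

section Cube

variable {d : ℕ}

/-- The points of the cube `{0, …, n - 1}^d` as lattice points. -/
def cubePoint {n : ℕ} (k : Fin d → Fin n) : Fin d → ℤ := fun i => ((k i : ℕ) : ℤ)

theorem cubePoint_injective (n : ℕ) :
    Function.Injective (cubePoint : (Fin d → Fin n) → Fin d → ℤ) := fun j k h => by
  funext i
  have := congrFun h i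
  simp only [cubePoint] at this
  exact Fin.ext (by exact_mod_cast this)

/-- The matrix of a kernel on `ℤ^d` restricted to the cube `{0, …, n - 1}^d`. -/
def cubeMatrix (K : (Fin d → ℤ) → (Fin d → ℤ) → ℝ) (n : ℕ) :
    Matrix (Fin d → Fin n) (Fin d → Fin n) ℝ :=
  Matrix.of fun j k => K (cubePoint j) (cubePoint k)

/-- The deficit of `log det` of a kernel of power `P` on a cube relative to white noise. -/
noncomputable def logDetDeficit (K : (Fin d → ℤ) → (Fin d → ℤ) → ℝ) (P : ℝ) (n : ℕ) : ℝ :=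
  Real.log (cubeMatrix K n).det - (n : ℝ) ^ d * Real.log P

/-- The tile of side `m` containing a point of a cube. -/
def cubeTile (m : ℕ) {n : ℕ} (k : Fin d → Fin n) : Lex (Fin d → Fin n) :=
  toLex fun i => ⟨(k i : ℕ) / m, (Nat.div_le_self _ _).trans_lt (k i).2⟩

theorem cubeTile_eq_iff {m n : ℕ} {k : Fin d → Fin n} {a : Lex (Fin d → Fin n)} :
    cubeTile m k = a ↔ ∀ i, (k i : ℕ) / m = (ofLex a i : ℕ) := by
  constructor
  · rintro rfl i; rfl
  · intro h
    exact funext fun i => Fin.ext (h i)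

variable {K : (Fin d → ℤ) → (Fin d → ℤ) → ℝ}

/-- The hypothesis selects the complete tiles, those not truncated by the boundary of the large
cube; `j ↦ a * m + j` parametrizes such a tile. -/
theorem exists_equiv_cubeTile {m n : ℕ} {a : Lex (Fin d → Fin n)}
    (ha : ∀ i, (ofLex a i : ℕ) < n / m) :
    ∃ e : (Fin d → Fin m) ≃ {k : Fin d → Fin n // cubeTile m k = a},
      ∀ j i, ((e j).1 i : ℕ) = (ofLex a i : ℕ) * m + j i := by
  have hlt : ∀ (j : Fin d → Fin m) i, (ofLex a i : ℕ) * m + j i < n := fun j i =>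
    calc (ofLex a i : ℕ) * m + j i < (ofLex a i : ℕ) * m + m := Nat.add_lt_add_left (j i).2 _
      _ = ((ofLex a i : ℕ) + 1) * m := by ring
      _ ≤ n / m * m := Nat.mul_le_mul_right m (ha i)
      _ ≤ n := Nat.div_mul_le_self n m
  let f : (Fin d → Fin m) → {k : Fin d → Fin n // cubeTile m k = a} := fun j =>
    ⟨fun i => ⟨(ofLex a i : ℕ) * m + j i, hlt j i⟩, cubeTile_eq_iff.2 fun i => by
      have hm : 0 < m := (Nat.zero_le _).trans_lt (j i).2
      change ((ofLex a i : ℕ) * m + j i) / m = _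
      rw [mul_comm, Nat.mul_add_div hm, Nat.div_eq_of_lt (j i).2, add_zero]⟩
  have hf : Function.Bijective f := by
    constructor
    · intro j j' h
      funext i
      have := congrArg Fin.val (congrFun (congrArg Subtype.val h) i)
      simp only [f] at this
      exact Fin.ext (by omega)
    · rintro ⟨k, hk⟩
      have hk' := cubeTile_eq_iff.1 hk
      have hm : Fin d → 0 < m := fun i => by
        rcases Nat.eq_zero_or_pos m with h | h
        · have := ha i; simp [h] at this
        · exact h
      refine ⟨fun i => ⟨(k i : ℕ) % m, Nat.mod_lt _ (hm i)⟩, Subtype.ext (funext fun i =>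
        Fin.ext ?_)⟩
      change (ofLex a i : ℕ) * m + (k i : ℕ) % m = k i
      rw [← hk' i, Nat.div_add_mod']
  exact ⟨Equiv.ofBijective f hf, fun j i => rfl⟩

theorem det_toSquareBlock_cubeTile (hK : ∀ j k l, K (j + l) (k + l) = K j k) {m n : ℕ}
    {a : Lex (Fin d → Fin n)} (ha : ∀ i, (ofLex a i : ℕ) < n / m) :
    ((cubeMatrix K n).toSquareBlock (cubeTile m) a).det = (cubeMatrix K m).det := by
  obtain ⟨e, he⟩ := exists_equiv_cubeTile ha
  rw [← Matrix.det_submatrix_equiv_self e]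
  congr 1
  ext j k
  have hp : ∀ j : Fin d → Fin m, cubePoint (e j).1 =
      cubePoint j + fun i => (((ofLex a i : ℕ) * m : ℕ) : ℤ) := fun j => by
    funext i
    simp [cubePoint, he, add_comm]
  change K (cubePoint (e j).1) (cubePoint (e k).1) = K (cubePoint j) (cubePoint k)
  rw [hp, hp, hK]

variable {P : ℝ}

theorem logDetDeficit_nonpos (hP : 0 < P) (hdiag : ∀ k, K k k = P)
    {n : ℕ} (hpd : (cubeMatrix K n).PosDef) : logDetDeficit K P n ≤ 0 := by
  have h := hpd.log_det_le_of_diag_eq hP fun k => hdiag _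
  simp only [Fintype.card_fun, Fintype.card_fin] at h
  push_cast at h
  exact sub_nonpos.2 h

theorem cubeMatrix_eq_of_logDetDeficit_eq_zero (hP : 0 < P) (hdiag : ∀ k, K k k = P)
    {n : ℕ} (hpd : (cubeMatrix K n).PosDef) (h : logDetDeficit K P n = 0) :
    cubeMatrix K n = P • 1 := by
  refine hpd.eq_smul_one_of_log_det_eq hP (fun k => hdiag _) ?_
  simp only [Fintype.card_fun, Fintype.card_fin]
  push_cast
  exact sub_eq_zero.1 h

theorem logDetDeficit_eq_zero (hdiag : ∀ k, K k k = P) (hoff : ∀ j k, j ≠ k → K j k = 0)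
    (n : ℕ) : logDetDeficit K P n = 0 := by
  have h : cubeMatrix K n = Matrix.diagonal fun _ => P := by
    ext j k
    by_cases hjk : j = k
    · subst hjk; simp [cubeMatrix, hdiag]
    · simp [cubeMatrix, hjk, hoff _ _ ((cubePoint_injective n).ne hjk)]
  rw [logDetDeficit, h, Matrix.det_diagonal]
  simp

/-- Fischer's inequality bounds the deficit by the sum over tiles. Each complete tile is a translate
of the cube of side `m` and contributes its deficit. Measuring against white noise makes every
contribution nonpositive, so truncated tiles are simply dropped. -/
theorem logDetDeficit_le (hK : ∀ j k l, K (j + l) (k + l) = K j k) (hP : 0 < P)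
    (hdiag : ∀ k, K k k = P) {n : ℕ} (hpd : (cubeMatrix K n).PosDef) (m : ℕ) :
    logDetDeficit K P n ≤ ((n / m : ℕ) : ℝ) ^ d * logDetDeficit K P m := by
  set G := cubeMatrix K n
  have hblock : ∀ a, (G.toSquareBlock (cubeTile m) a).PosDef := fun a =>
    hpd.toSquareBlock (cubeTile m) a
  let f : Lex (Fin d → Fin n) → ℝ := fun a => Real.log (G.toSquareBlock (cubeTile m) a).det -
    Fintype.card {k : Fin d → Fin n // cubeTile m k = a} * Real.log P
  have hf : ∀ a, f a ≤ 0 := fun a =>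
    sub_nonpos.2 ((hblock a).log_det_le_of_diag_eq hP fun k => hdiag _)
  have hcard : ∑ a, (Fintype.card {k : Fin d → Fin n // cubeTile m k = a} : ℝ) = (n : ℝ) ^ d := by
    have h := Fintype.card_congr (Equiv.sigmaFiberEquiv (cubeTile m : (Fin d → Fin n) → _))
    rw [Fintype.card_sigma] at h
    have h' := congrArg (Nat.cast : ℕ → ℝ) h
    simpa using h'
  have hle : logDetDeficit K P n ≤ ∑ a, f a := by
    have h1 := Real.log_le_log hpd.det_pos (hpd.det_le_prod_det_toSquareBlock (cubeTile m))
    rw [Real.log_prod fun a _ => (hblock a).det_pos.ne'] at h1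
    simp only [f, Finset.sum_sub_distrib, ← Finset.sum_mul, hcard]
    exact sub_le_sub_right h1 _
  -- The indices of the complete tiles.
  let T : Finset (Fin d → Fin n) := Fintype.piFinset fun _ => Finset.univ.filter (·.1 < n / m)
  have hT : T.card = (n / m) ^ d := by
    have h1 : (Finset.univ.filter fun x : Fin n => x.1 < n / m).card = n / m := by
      rw [Fin.card_filter_val_lt, min_eq_right (Nat.div_le_self n m)]
    simp [T, Fintype.card_piFinset, h1]
  have hval : ∀ a ∈ T.map toLex.toEmbedding, f a = logDetDeficit K P m := by
    intro a ha
    obtain ⟨a, haT, rfl⟩ := Finset.mem_map.1 ha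
    have ha' : ∀ i, (ofLex (toLex a) i : ℕ) < n / m := fun i => by
      simpa using Fintype.mem_piFinset.1 haT i
    obtain ⟨e, -⟩ := exists_equiv_cubeTile ha'
    change Real.log (G.toSquareBlock (cubeTile m) (toLex a)).det - _ = _
    rw [det_toSquareBlock_cubeTile hK ha', logDetDeficit, Equiv.toEmbedding_apply,
      ← Fintype.card_congr e]
    simp
  calc logDetDeficit K P n ≤ ∑ a, f a := hle
    _ ≤ ∑ a ∈ T.map toLex.toEmbedding, f a := by
      rw [← neg_le_neg_iff, ← Finset.sum_neg_distrib, ← Finset.sum_neg_distrib]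
      exact Finset.sum_le_sum_of_subset_of_nonneg (Finset.subset_univ _)
        fun a _ _ => neg_nonneg.2 (hf a)
    _ = ((n / m : ℕ) : ℝ) ^ d * logDetDeficit K P m := by
      rw [Finset.sum_congr rfl hval, Finset.sum_const, Finset.card_map, hT]
      simp

end Cube

/-! ### Entropy rate of a stationary Gaussian field. -/

section EntropyRate

variable {d : ℕ} {Ω : Type*} [MeasurableSpace Ω] {μ : Measure Ω}
  {K : (Fin d → ℤ) → (Fin d → ℤ) → ℝ} {P : ℝ}

/-- The normalized entropy on a cube of the Gaussian field of power `P` with kernel `K`. -/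
noncomputable def gaussianCubeRate (K : (Fin d → ℤ) → (Fin d → ℤ) → ℝ) (P : ℝ) (n : ℕ) : ℝ :=
  Real.log (2 * Real.pi * Real.exp 1 * P) / 2 + logDetDeficit K P n / (n : ℝ) ^ d / 2

theorem gaussianCubeRate_le (hP : 0 < P) (hdiag : ∀ k, K k k = P) {n : ℕ}
    (hpd : (cubeMatrix K n).PosDef) :
    gaussianCubeRate K P n ≤ Real.log (2 * Real.pi * Real.exp 1 * P) / 2 := by
  have h : logDetDeficit K P n / (n : ℝ) ^ d ≤ 0 :=
    div_nonpos_of_nonpos_of_nonneg (logDetDeficit_nonpos hP hdiag hpd) (by positivity)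
  unfold gaussianCubeRate
  linarith

theorem differentialEntropy_cubeLaw {g : (Fin d → ℤ) → Ω → ℝ} (hg : IsGaussianProcess g μ)
    (hmean : ∀ k, ∫ ω, g k ω ∂μ = 0) (hcov : ∀ j k, cov[g j, g k; μ] = K j k) {n : ℕ}
    (hpd : (cubeMatrix K n).PosDef) :
    differentialEntropy (cubeLaw g μ n) =
      (((n : ℝ) ^ d * (Real.log (2 * Real.pi * Real.exp 1) / 2) +
        Real.log (cubeMatrix K n).det / 2 : ℝ) : EReal) := by
  have hlaw : HasGaussianLaw (fun ω (k : Fin d → Fin n) => g (cubePoint k) ω) μ := by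
    have h := (hg.comp_right (cubePoint : (Fin d → Fin n) → _)).hasGaussianLaw Finset.univ
    let L : ({x // x ∈ (Finset.univ : Finset (Fin d → Fin n))} → ℝ) →L[ℝ] (Fin d → Fin n) → ℝ :=
      ContinuousLinearMap.pi fun k => ContinuousLinearMap.proj ⟨k, Finset.mem_univ k⟩
    exact h.map L
  have hmap : cubeLaw g μ n = μ.map fun ω (k : Fin d → Fin n) => g (cubePoint k) ω := rfl
  have hgauss : IsGaussian (cubeLaw g μ n) := hlaw.isGaussian_map
  have hmeas : AEMeasurable (fun ω (k : Fin d → Fin n) => g (cubePoint k) ω) μ := hlaw.aemeasurable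
  have heval : ∀ k : Fin d → Fin n, AEStronglyMeasurable (fun x : (Fin d → Fin n) → ℝ => x k)
      (μ.map fun ω (k : Fin d → Fin n) => g (cubePoint k) ω) := fun k =>
    (measurable_pi_apply k).aestronglyMeasurable
  have h := differentialEntropy_of_isGaussian (ν := cubeLaw g μ n) hpd ?_ ?_
  · rw [h]
    simp
  · intro k
    rw [hmap, integral_map hmeas (heval k)]
    exact hmean (cubePoint k)
  · intro j k
    rw [hmap, covariance_map (heval j) (heval k) hmeas]
    exact hcov (cubePoint j) (cubePoint k)

/-- Divided by `n ^ d`, the tiling inequality dominates the `n`-th rate by a sequence tending to the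
`m`-th. Keeping the limit as an infimum over cubes is what the equality case needs. -/
theorem hasEntropyRate_of_isGaussianProcess {g : (Fin d → ℤ) → Ω → ℝ} (hg : IsGaussianProcess g μ)
    (hmean : ∀ k, ∫ ω, g k ω ∂μ = 0) (hcov : ∀ j k, cov[g j, g k; μ] = K j k)
    (hpd : ∀ n, (cubeMatrix K n).PosDef) (hK : ∀ j k l, K (j + l) (k + l) = K j k) (hP : 0 < P)
    (hdiag : ∀ k, K k k = P) :
    HasEntropyRate g μ (⨅ m : ℕ, (gaussianCubeRate K P (m + 1) : EReal)) := by
  have hlim : Tendsto (fun n => (gaussianCubeRate K P n : EReal)) atTop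
      (𝓝 (⨅ m : ℕ, (gaussianCubeRate K P (m + 1) : EReal))) := by
    refine tendsto_iInf_of_eventually_le fun m _ => ?_
    refine ⟨fun n => Real.log (2 * Real.pi * Real.exp 1 * P) / 2 +
      (((n / m : ℕ) : ℝ) / n) ^ d * logDetDeficit K P m / 2, ?_, Eventually.of_forall fun n => ?_⟩
    · have h := ((((tendsto_natDiv_div m).pow d).mul_const (logDetDeficit K P m)).div_const
        2).const_add (Real.log (2 * Real.pi * Real.exp 1 * P) / 2)
      rwa [inv_pow, inv_mul_eq_div] at h
    · have h := div_le_div_of_nonneg_right (logDetDeficit_le hK hP hdiag (hpd n) m)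
        (by positivity : (0 : ℝ) ≤ (n : ℝ) ^ d)
      rw [mul_div_right_comm, ← div_pow] at h
      simp only [gaussianCubeRate]
      linarith
  refine hlim.congr' ?_
  filter_upwards [eventually_ge_atTop 1] with n hn
  have hn' : (0 : ℝ) < (n : ℝ) ^ d := by positivity
  rw [differentialEntropy_cubeLaw hg hmean hcov (hpd n), ← EReal.coe_div]
  congr 1
  rw [gaussianCubeRate, logDetDeficit, Real.log_mul (by positivity) hP.ne']
  field_simp
  ring

theorem gaussianCubeRate_of_off_diag_eq_zero (hdiag : ∀ k, K k k = P)
    (hoff : ∀ j k, j ≠ k → K j k = 0) (n : ℕ) :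
    gaussianCubeRate K P n = Real.log (2 * Real.pi * Real.exp 1 * P) / 2 := by
  rw [gaussianCubeRate, logDetDeficit_eq_zero hdiag hoff]
  simp

end EntropyRate

/-! ### Gaussian white noise, the extremal field. -/

section WhiteNoise

variable {d : ℕ}

/-- The law of Gaussian white noise of variance `P` on `ℤ^d`. -/
noncomputable def whiteNoise (d : ℕ) (P : ℝ) : Measure ((Fin d → ℤ) → ℝ) :=
  Measure.infinitePi fun _ => gaussianReal 0 P.toNNReal

instance (P : ℝ) : IsProbabilityMeasure (whiteNoise d P) := by
  unfold whiteNoise; infer_instance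

theorem whiteNoise_map_eval (P : ℝ) (k : Fin d → ℤ) :
    (whiteNoise d P).map (fun ω => ω k) = gaussianReal 0 P.toNNReal :=
  Measure.infinitePi_map_eval _ k

theorem whiteNoise_hasGaussianLaw (P : ℝ) (k : Fin d → ℤ) :
    HasGaussianLaw (fun ω : (Fin d → ℤ) → ℝ => ω k) (whiteNoise d P) :=
  ⟨by rw [whiteNoise_map_eval]; infer_instance⟩

theorem whiteNoise_iIndepFun (P : ℝ) :
    iIndepFun (fun (k : Fin d → ℤ) (ω : (Fin d → ℤ) → ℝ) => ω k) (whiteNoise d P) :=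
  iIndepFun_infinitePi (X := fun _ x => x) fun _ => measurable_id

theorem whiteNoise_isGaussianProcess (P : ℝ) :
    IsGaussianProcess (fun (k : Fin d → ℤ) (ω : (Fin d → ℤ) → ℝ) => ω k) (whiteNoise d P) where
  hasGaussianLaw _ := iIndepFun.hasGaussianLaw (fun i => whiteNoise_hasGaussianLaw P i.1)
    ((whiteNoise_iIndepFun P).precomp Subtype.val_injective)

theorem whiteNoise_mean (P : ℝ) (k : Fin d → ℤ) : ∫ ω, ω k ∂(whiteNoise d P) = 0 := by
  have h := integral_map (μ := whiteNoise d P) (φ := fun ω => ω k) (f := id)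
    (measurable_pi_apply k).aemeasurable (by fun_prop)
  rw [whiteNoise_map_eval] at h
  simpa using h.symm

theorem whiteNoise_cov {P : ℝ} (hP : 0 ≤ P) (j k : Fin d → ℤ) :
    cov[fun ω => ω j, fun ω => ω k; whiteNoise d P] = if j = k then P else 0 := by
  split_ifs with h
  · subst h
    have hv := variance_map (μ := whiteNoise d P) (Y := fun ω : (Fin d → ℤ) → ℝ => ω j) (X := id)
      (by fun_prop) (measurable_pi_apply j).aemeasurable
    rw [whiteNoise_map_eval, variance_id_gaussianReal, Real.coe_toNNReal _ hP] at hv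
    rw [covariance_self (measurable_pi_apply j).aemeasurable]
    exact hv.symm
  · exact ((whiteNoise_iIndepFun P).indepFun h).covariance_eq_zero
      (whiteNoise_hasGaussianLaw P j).memLp_two (whiteNoise_hasGaussianLaw P k).memLp_two

theorem whiteNoise_isCenteredWSS {P : ℝ} (hP : 0 ≤ P) :
    IsCenteredWSS (fun (k : Fin d → ℤ) (ω : (Fin d → ℤ) → ℝ) => ω k) (whiteNoise d P) where
  memLp k := (whiteNoise_hasGaussianLaw P k).memLp_two
  mean_zero := whiteNoise_mean P
  cov_shift j k m := by simp only [whiteNoise_cov hP, add_left_inj]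

theorem whiteNoise_hasPSD {b : Module.Basis (Fin d) ℝ (EuclideanSpace ℝ (Fin d))}
    {F : Set (EuclideanSpace ℝ (Fin d))} (hF : IsFrequencyDomain b F) {P : ℝ} (hP : 0 ≤ P) :
    HasPSD b F (fun (k : Fin d → ℤ) (ω : (Fin d → ℤ) → ℝ) => ω k) (whiteNoise d P)
      (fun _ => P / volume.real F) where
  integrableOn := by
    have := hF.isFiniteMeasure
    exact integrable_const _
  nonneg := ae_of_all _ fun _ => div_nonneg hP measureReal_nonneg
  cov_eq j k := by
    rw [whiteNoise_cov hP, integral_const_mul, hF.setIntegral_freqChar]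
    simp only [sub_eq_zero]
    split_ifs
    · rw [← Complex.ofReal_mul, div_mul_cancel₀ _ hF.measureReal_pos.ne']
    · simp

end WhiteNoise

/-! ### From the spectral density to covariances and back. -/

section Spectrum

variable {d : ℕ} {b : Module.Basis (Fin d) ℝ (EuclideanSpace ℝ (Fin d))}
  {F : Set (EuclideanSpace ℝ (Fin d))} {Ω : Type*} [MeasurableSpace Ω] {μ : Measure Ω}
  {z : (Fin d → ℤ) → Ω → ℝ} {S : EuclideanSpace ℝ (Fin d) → ℝ}

theorem HasPSD.cov_self (hS : HasPSD b F z μ S) (k : Fin d → ℤ) :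
    cov[z k, z k; μ] = ∫ ξ in F, S ξ := by
  have h := hS.cov_eq k k
  simp only [sub_self, freqChar_zero, mul_one] at h
  rw [integral_complex_ofReal] at h
  exact_mod_cast h

/-- The quadratic form of the covariance matrix is the integral of `S` against the squared modulus
of a trigonometric polynomial. -/
theorem HasPSD.posDef_cubeMatrix (hF : IsFrequencyDomain b F) (hS : HasPSD b F z μ S)
    (hpos : ∀ᵐ ξ ∂(volume.restrict F), 0 < S ξ) (n : ℕ) :
    (cubeMatrix (fun j k => cov[z j, z k; μ]) n).PosDef := by
  refine Matrix.PosDef.of_dotProduct_mulVec_pos ?_ fun x hx => ?_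
  · ext j k
    simp [cubeMatrix, covariance_comm]
  · have h := hF.integral_mul_normSq_pos (cubePoint_injective n) hS.integrableOn hpos hx
    have heq := integral_mul_normSq_sum_freqChar (b := b) (t := cubePoint (d := d) (n := n))
      hS.integrableOn x
    simp only [← hS.cov_eq] at heq
    have heq' : (∫ ξ in F, S ξ * ‖∑ i, (x i : ℂ) * freqChar b (cubePoint i) ξ‖ ^ 2) =
        ∑ i, ∑ j, x i * x j * cov[z (cubePoint i), z (cubePoint j); μ] := by exact_mod_cast heq
    rw [heq'] at h
    refine h.trans_eq ?_
    simp only [dotProduct, Matrix.mulVec, Finset.mul_sum, cubeMatrix, Matrix.of_apply,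
      Pi.star_apply, star_trivial]
    exact Finset.sum_congr rfl fun i _ => Finset.sum_congr rfl fun j _ => by ring

/-- Every lag is the difference of two points of some cube. -/
theorem exists_cubePoint_sub (k : Fin d → ℤ) :
    ∃ (m : ℕ) (p q : Fin d → Fin (m + 1)), cubePoint p - cubePoint q = k := by
  have hle : ∀ i, (k i).natAbs ≤ ∑ j, (k j).natAbs := fun i =>
    Finset.single_le_sum (f := fun j => (k j).natAbs) (fun _ _ => Nat.zero_le _)
      (Finset.mem_univ i)
  -- The two points are the coordinatewise positive and negative parts of `k`.
  refine ⟨∑ j, (k j).natAbs, fun i => ⟨(k i).toNat, ?_⟩, fun i => ⟨(-k i).toNat, ?_⟩, ?_⟩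
  · have := hle i; omega
  · have := hle i; omega
  · funext i
    simp only [cubePoint, Pi.sub_apply]
    omega

/-- Every nonzero lag occurs off the diagonal of some cube matrix, so every nonconstant Fourier
coefficient of `S` vanishes. -/
theorem HasPSD.ae_eq_flat (hF : IsFrequencyDomain b F) (hS : HasPSD b F z μ S)
    (h : ∀ m, cubeMatrix (fun j k => cov[z j, z k; μ]) (m + 1) = (∫ ξ in F, S ξ) • 1) :
    S =ᵐ[volume.restrict F] fun _ => (∫ ξ in F, S ξ) / volume.real F := by
  refine hF.ae_eq_const_of_integral_eq_zero hS.integrableOn hS.nonneg fun k hk => ?_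
  obtain ⟨m, p, q, hpq⟩ := exists_cubePoint_sub k
  have hne : p ≠ q := by
    rintro rfl
    exact hk (by rw [← hpq, sub_self])
  have hz : cov[z (cubePoint p), z (cubePoint q); μ] = 0 := by
    have := congrFun (congrFun (h m) p) q
    simpa [cubeMatrix, hne] using this
  rw [← hpq, ← hS.cov_eq, hz, Complex.ofReal_zero]

theorem HasPSD.cov_eq_zero_of_flat (hF : IsFrequencyDomain b F) (hS : HasPSD b F z μ S) {c : ℝ}
    (h : S =ᵐ[volume.restrict F] fun _ => c) {j k : Fin d → ℤ} (hjk : j ≠ k) :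
    cov[z j, z k; μ] = 0 := by
  have h1 := hS.cov_eq j k
  have h2 : ∫ ξ in F, (S ξ : ℂ) * freqChar b (j - k) ξ =
      ∫ ξ in F, (c : ℂ) * freqChar b (j - k) ξ := by
    refine integral_congr_ae ?_
    filter_upwards [h] with ξ hξ
    rw [hξ]
  rw [h2, integral_const_mul, hF.setIntegral_freqChar_of_ne (sub_ne_zero.2 hjk), mul_zero] at h1
  exact_mod_cast h1

end Spectrum

/-! ### The maximum entropy theorem. -/

theorem lemma1 {d : ℕ} (b : Module.Basis (Fin d) ℝ (EuclideanSpace ℝ (Fin d)))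
    (F : Set (EuclideanSpace ℝ (Fin d))) (hF : IsFrequencyDomain b F) (P : ℝ) (hP : 0 < P) :
    ∃ hmax : ℝ,
      -- the flat spectrum is that of an actual Gaussian field, whose entropy rate is `hmax`
      (∃ (Ω : Type) (_ : MeasurableSpace Ω) (μ : Measure Ω) (_ : IsProbabilityMeasure μ)
          (z : (Fin d → ℤ) → Ω → ℝ),
        IsCenteredWSS z μ ∧ IsGaussianProcess z μ ∧
          HasPSD b F z μ (fun _ => P / volume.real F) ∧ HasEntropyRate z μ (hmax : EReal)) ∧
      -- `hmax` bounds the entropy rate for every spectrum of power `P`, with equality exactly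
      -- for the flat one
      ∀ (Ω : Type*) [MeasurableSpace Ω] (μ : Measure Ω) [IsProbabilityMeasure μ]
        (z : (Fin d → ℤ) → Ω → ℝ) (S : EuclideanSpace ℝ (Fin d) → ℝ),
        IsCenteredWSS z μ → HasPSD b F z μ S →
        (∀ᵐ ξ ∂(volume.restrict F), 0 < S ξ) → ∫ ξ in F, S ξ = P →
        ∀ (Ω' : Type*) [MeasurableSpace Ω'] (μ' : Measure Ω') [IsProbabilityMeasure μ']
          (g : (Fin d → ℤ) → Ω' → ℝ), IsGaussianReference g μ' z μ →
          ∃ h : EReal, HasEntropyRate g μ' h ∧ h ≤ (hmax : EReal) ∧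
            (h = (hmax : EReal) ↔ S =ᵐ[volume.restrict F] fun _ => P / volume.real F) := by
  have hwpd : ∀ n, (cubeMatrix (fun j k : Fin d → ℤ => if j = k then P else 0) n).PosDef := by
    intro n
    have h : cubeMatrix (fun j k : Fin d → ℤ => if j = k then P else 0) n =
        Matrix.diagonal fun _ => P := by
      ext j k
      simp [cubeMatrix, Matrix.diagonal_apply, (cubePoint_injective n).eq_iff]
    rw [h]
    exact Matrix.PosDef.diagonal fun _ => hP
  -- The maximum is the entropy of a single Gaussian of variance `P`, the rate of white noise.
  refine ⟨Real.log (2 * Real.pi * Real.exp 1 * P) / 2,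
    ⟨(Fin d → ℤ) → ℝ, inferInstance, whiteNoise d P, inferInstance, fun k ω => ω k,
      whiteNoise_isCenteredWSS hP.le, whiteNoise_isGaussianProcess P, whiteNoise_hasPSD hF hP.le,
      ?_⟩, ?_⟩
  · have h := hasEntropyRate_of_isGaussianProcess (whiteNoise_isGaussianProcess P)
      (whiteNoise_mean P) (whiteNoise_cov hP.le) hwpd (fun j k l => by simp) hP (by simp)
    simpa only [gaussianCubeRate_of_off_diag_eq_zero (P := P)
      (K := fun j k : Fin d → ℤ => if j = k then P else 0) (by simp)
      (fun j k hjk => if_neg hjk), ciInf_const] using h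
  intro Ω _ μ _ z S hz hS hpos hint Ω' _ μ' _ g hg
  have hpd := hS.posDef_cubeMatrix hF hpos
  have hdiag : ∀ k, cov[z k, z k; μ] = P := fun k => (hS.cov_self k).trans hint
  refine ⟨_, hasEntropyRate_of_isGaussianProcess hg.gaussian hg.mean_zero hg.cov_eq hpd
    (fun j k l => hz.cov_shift j k l) hP hdiag, ?_, fun h => ?_, fun h => ?_⟩
  · exact (iInf_le _ 0).trans (EReal.coe_le_coe_iff.2 (gaussianCubeRate_le hP hdiag (hpd 1)))
  · rw [← hint]
    refine hS.ae_eq_flat hF fun m => ?_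
    rw [hint]
    refine cubeMatrix_eq_of_logDetDeficit_eq_zero hP hdiag (hpd _) ?_
    -- If the infimum reaches the upper bound common to all terms, every term equals it, so every
    -- deficit is zero.
    have h1 : Real.log (2 * Real.pi * Real.exp 1 * P) / 2 ≤
        gaussianCubeRate (fun j k => cov[z j, z k; μ]) P (m + 1) :=
      EReal.coe_le_coe_iff.1 (h.symm.trans_le (iInf_le _ m))
    have h2 := gaussianCubeRate_le hP hdiag (hpd (m + 1))
    have h3 := le_antisymm h2 h1
    have hn : ((m + 1 : ℕ) : ℝ) ^ d ≠ 0 := by positivity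
    simpa [gaussianCubeRate, hn, -Nat.cast_add] using h3
  · simp only [gaussianCubeRate_of_off_diag_eq_zero hdiag
      (fun j k hjk => hS.cov_eq_zero_of_flat hF h hjk), ciInf_const]
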